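/- For a metric space $Z$ and $p,x,y\in Z$ let $(x.y)_p=\tfrac12\{d(p,x)+d(p,y)-d(x,y)\}$. The space $Z$ is (Gromov) hyperbolic if there is $\delta\ge 0$ with $(x.y)_p\ge\min\{(x.z)_p,(y.z)_p\}-\delta$ for all $p,x,y,z\in Z$, and it is a length space if the distance between any two points is the infimum of the lengths of the paths joining them. The sequential boundary $\partial_s Z$ of a hyperbolic space $Z$ is the set of sequences $\{x_n\}$ in $Z$ with $\lim_{i,j\to\infty}(x_i.x_j)_p=\infty$, modulo the equivalence relation $\{x_n\}\sim\{y_n\}$ if and only if $\lim_{i,j\to\infty}(x_i.y_j)_p=\infty$ (for any base point $p$); one writes $x_n\to\xi$ if $\xi=[\{x_n\}]$. A sequence $\xi_n=[\{x^n_k\}_k]$ in $\partial_s Z$ converges to $\xi=[\{x_k\}]$ if $\lim_{n\to\infty}\bigl(\liminf_{i,j\to\infty}(x_i.x^n_j)_p\bigr)=\infty$, and a subset of $\partial_s Z$ is closed if it contains the limits of all convergent sequences of its points. A $(1,1)$-quasigeodesic joining $x$ to $y$ is a (not necessarily continuous) map $\gamma:[a,b]\to Z$ with $\gamma(a)=x$,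 $\gamma(b)=y$ and $|s-t|-1\le d(\gamma(s),\gamma(t))\le|s-t|+1$ for all $s,t\in[a,b]$. $B(z,R)$ denotes the open ball, which is empty if $R\le 0$. **Mitra's lemma.** Let $X$ and $Y$ be length spaces that are hyperbolic in the sense of Gromov, let $f:Y\to X$ be any map and let $p\in Y$. Suppose that there is a function $M:(0,\infty)\to\mathbb R$ with $M(N)\to\infty$ as $N\to\infty$ such that the following holds for all $N>0$: for any $y_1,y_2\in Y$, any $(1,1)$-quasigeodesic $\alpha$ in $Y$ joining $y_1$ to $y_2$ and any $(1,1)$-quasigeodesic $\beta$ in $X$ joining $f(y_1)$ to $f(y_2)$, if $B(p,N)\cap\alpha=\emptyset$ then $B(f(p),M(N))\cap\beta=\emptyset$. Then the Cannon–Thurston map exists for $f$: for every $\xi\in\partial_s Y$ and every sequence $\{y_n\}$ in $Y$ with $y_n\to\xi$, the sequence $\{f(y_n)\}$ converges to a point $\partial f(\xi)\in\partial_s X$ that depends only on $\xi$, and the resulting map $\partial f:\partial_s Y\to\partial_s X$ is continuous. -/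

import Mathlib

open Filter Topology

/-- A length space: the distance between two points is the infimum of the lengths of the continuous
paths joining them. (The infimum over an empty family is `⊤`, so `X` is path connected, and
paths of infinite length do not affect the infimum.) -/
def IsLengthSpace (X : Type*) [MetricSpace X] : Prop :=
  ∀ x y : X, edist x y = ⨅ γ : Path x y, eVariationOn (γ : unitInterval → X) Set.univ

/-- The Gromov inner product `(x.y)_p`. -/
noncomputable def gromovProduct {X : Type*} [MetricSpace X] (p x y : X) : ℝ :=
  (dist p x + dist p y - dist x y) / 2

/-- Hyperbolicity in the sense of Gromov. -/
class GromovHyperbolic (X : Type*) [MetricSpace X] : Prop where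
  exists_delta : ∃ δ : ℝ, 0 ≤ δ ∧ ∀ p x y z : X,
    min (gromovProduct p x z) (gromovProduct p y z) - δ ≤ gromovProduct p x y

/-- `γ`, restricted to the compact interval `[a, b]`, is a `(k, ε)`-quasigeodesic joining `x` to `y`.
No continuity is required. -/
def IsQuasigeodesicJoining {X : Type*} [MetricSpace X] (k ε : ℝ) (γ : ℝ → X) (a b : ℝ) (x y : X) :
    Prop :=
  a ≤ b ∧ γ a = x ∧ γ b = y ∧ ∀ s ∈ Set.Icc a b, ∀ t ∈ Set.Icc a b,
    |s - t| / k - ε ≤ dist (γ s) (γ t) ∧ dist (γ s) (γ t) ≤ k * |s - t| + ε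

section Boundary

variable {X : Type*} [MetricSpace X]

/-- `lim_{i,j → ∞} (x_i.y_j)_p = ∞` for every base point `p`. -/
def GromovAsymptotic (x y : ℕ → X) : Prop :=
  ∀ p : X, Tendsto (fun ij : ℕ × ℕ => gromovProduct p (x ij.1) (y ij.2)) atTop atTop

/-- The sequence `x` converges to infinity. -/
def ConvergesToInfinity (x : ℕ → X) : Prop := GromovAsymptotic x x

theorem gromovProduct_comm (p x y : X) : gromovProduct p x y = gromovProduct p y x := by
  simp only [gromovProduct, dist_comm x y]; ring

theorem GromovAsymptotic.symm {x y : ℕ → X} (h : GromovAsymptotic x y) : GromovAsymptotic y x := by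
  intro p
  have hs : Tendsto (Prod.swap : ℕ × ℕ → ℕ × ℕ) atTop atTop := by
    rw [← prod_atTop_atTop_eq]; exact tendsto_snd.prodMk tendsto_fst
  refine ((h p).comp hs).congr fun ij => ?_
  simp [gromovProduct_comm p (x ij.2) (y ij.1)]

theorem GromovAsymptotic.trans [GromovHyperbolic X] {x y z : ℕ → X} (h : GromovAsymptotic x y)
    (h' : GromovAsymptotic y z) : GromovAsymptotic x z := by
  intro p
  obtain ⟨δ, -, hδ⟩ := GromovHyperbolic.exists_delta (X := X)
  rw [tendsto_atTop]
  intro C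
  obtain ⟨⟨a, b⟩, hab⟩ := eventually_atTop.1 ((tendsto_atTop.1 (h p)) (C + δ))
  obtain ⟨⟨c, d⟩, hcd⟩ := eventually_atTop.1 ((tendsto_atTop.1 (h' p)) (C + δ))
  refine eventually_atTop.2 ⟨(a, d), fun ij hij => ?_⟩
  have h1 := hab (ij.1, max b c) ⟨hij.1, le_max_left _ _⟩
  have h2 := hcd (max b c, ij.2) ⟨le_max_right _ _, hij.2⟩
  have h3 := hδ p (x ij.1) (z ij.2) (y (max b c))
  rw [gromovProduct_comm p (z ij.2)] at h3
  have h4 := le_min h1 h2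
  simp only at h4
  linarith

end Boundary

/-- Two sequences converging to infinity are equivalent when `lim (x_i.y_j)_p = ∞`. -/
def gromovSetoid (X : Type*) [MetricSpace X] [GromovHyperbolic X] :
    Setoid {x : ℕ → X // ConvergesToInfinity x} where
  r x y := GromovAsymptotic x.1 y.1
  iseqv := ⟨fun x => x.2, fun h => h.symm, fun h h' => h.trans h'⟩

/-- The sequential (Gromov) boundary `∂_s X`. -/
def GromovBoundary (X : Type*) [MetricSpace X] [GromovHyperbolic X] : Type _ :=
  Quotient (gromovSetoid X)

section Topology

variable {X : Type*} [MetricSpace X] [GromovHyperbolic X]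

/-- `x_n → ξ ∈ ∂_s X`: the sequence `x` of points of `X` converges to infinity and represents `ξ`. -/
def ConvergesToBoundary (x : ℕ → X) (ξ : GromovBoundary X) : Prop :=
  ∃ h : ConvergesToInfinity x, Quotient.mk (gromovSetoid X) ⟨x, h⟩ = ξ

/-- Convergence `ξ_n → ξ` in `∂_s X`: for representatives `ξ_n = [{u n k}_k]` and `ξ = [{x k}_k]`,
`lim_{n → ∞} liminf_{i,j → ∞} (x_i.u^n_j)_p = ∞`. The inferior limits may be infinite and are taken
in the extended reals. -/
def BoundaryTendsto (ξs : ℕ → GromovBoundary X) (ξ : GromovBoundary X) : Prop :=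
  ∀ (p : X) (u : ℕ → ℕ → X) (x : ℕ → X),
    (∀ n, ConvergesToBoundary (u n) (ξs n)) → ConvergesToBoundary x ξ →
    Tendsto (fun n => liminf
      (fun ij : ℕ × ℕ => ((gromovProduct p (x ij.1) (u n ij.2) : ℝ) : EReal)) atTop) atTop (𝓝 ⊤)

theorem exists_convergesToBoundary (ξ : GromovBoundary X) : ∃ x, ConvergesToBoundary x ξ := by
  obtain ⟨x, hx⟩ := Quotient.exists_rep ξ
  exact ⟨x.1, x.2, hx⟩

theorem BoundaryTendsto.subseq {ξs : ℕ → GromovBoundary X} {ξ : GromovBoundary X}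
    (h : BoundaryTendsto ξs ξ) {φ : ℕ → ℕ} (hφ : StrictMono φ) :
    BoundaryTendsto (ξs ∘ φ) ξ := by
  intro p u x hu hx
  choose v hv using fun n => exists_convergesToBoundary (ξs n)
  classical
  let w : ℕ → ℕ → X := fun n => if hn : ∃ m, φ m = n then u hn.choose else v n
  have hw : ∀ m, w (φ m) = u m := by
    intro m
    have hn : ∃ m', φ m' = φ m := ⟨m, rfl⟩
    simp only [w, dif_pos hn, hφ.injective hn.choose_spec]
  have hwc : ∀ n, ConvergesToBoundary (w n) (ξs n) := by
    intro n
    by_cases hn : ∃ m, φ m = n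
    · obtain ⟨m, rfl⟩ := hn
      rw [hw]; exact hu m
    · simp only [w, dif_neg hn]; exact hv n
  have := (h p w x hwc hx).comp hφ.tendsto_atTop
  refine this.congr fun n => ?_
  simp only [Function.comp, hw]

/-- The topology of `∂_s X`: a subset is closed if it is closed under limits of sequences. -/
instance : TopologicalSpace (GromovBoundary X) :=
  TopologicalSpace.ofClosed
    {A | ∀ (ξs : ℕ → GromovBoundary X) (ξ : GromovBoundary X),
      (∀ n, ξs n ∈ A) → BoundaryTendsto ξs ξ → ξ ∈ A}
    (fun _ _ h _ => (h 0).elim)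
    (fun _ hT ξs ξ h hξ A hA => hT hA ξs ξ (fun n => h n A hA) hξ)
    (by
      intro A hA B hB ξs ξ h hξ
      by_cases hfr : ∃ᶠ n in atTop, ξs n ∈ A
      · obtain ⟨φ, hφ, hφA⟩ := extraction_of_frequently_atTop hfr
        exact Or.inl (hA _ _ hφA (hξ.subseq hφ))
      · have hfr' : ∃ᶠ n in atTop, ξs n ∈ B :=
          ((not_frequently.1 hfr).mono fun n hn => (h n).resolve_left hn).frequently
        obtain ⟨φ, hφ, hφB⟩ := extraction_of_frequently_atTop hfr'
        exact Or.inr (hB _ _ hφB (hξ.subseq hφ)))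

end Topology

/-- The Cannon–Thurston map exists for `f : Y → X`: there is a continuous map
`∂f : ∂_s Y → ∂_s X` such that whenever a sequence `y` in `Y` converges to `ξ ∈ ∂_s Y`,
the sequence `f ∘ y` converges to `∂f ξ`. -/
def CannonThurstonMapExists {Y X : Type*} [MetricSpace Y] [GromovHyperbolic Y]
    [MetricSpace X] [GromovHyperbolic X] (f : Y → X) : Prop :=
  ∃ F : GromovBoundary Y → GromovBoundary X, Continuous F ∧
    ∀ (ξ : GromovBoundary Y) (y : ℕ → Y),
      ConvergesToBoundary y ξ → ConvergesToBoundary (f ∘ y) (F ξ)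

/-! ### Gromov products versus distances to coarse geodesics. -/

section GromovProduct

variable {X : Type*} [MetricSpace X]

/-! Up to a bounded error, `(x.y)_q` is the distance from `q` to a coarse geodesic from `x` to `y`:
the upper bound (`gromovProduct_le_dist_add`) is the triangle inequality, the converse
(`exists_dist_le_gromovProduct_add`) needs hyperbolicity. Length spaces supply such coarse
geodesics, so the hypothesis on `M` says that `(f y₁.f y₂)_q` tends to infinity with `(y₁.y₂)_p`,
uniformly in the pair. Equivalence of sequences and boundary convergence are phrased by such
products, hence both pass through `f`. -/

theorem gromovProduct_sub_dist_le (p q x y : X) :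
    gromovProduct p x y - dist p q ≤ gromovProduct q x y := by
  have h1 := dist_triangle p q x
  have h2 := dist_triangle p q y
  simp only [gromovProduct]
  linarith

theorem gromovProduct_le_dist_add {x y z : X} {ε : ℝ}
    (h : dist x z + dist z y ≤ dist x y + ε) (p : X) :
    gromovProduct p x y ≤ dist p z + ε / 2 := by
  have h1 := dist_triangle p z x
  have h2 := dist_triangle p z y
  rw [dist_comm z x] at h1
  simp only [gromovProduct]
  linarith

/-- In a hyperbolic space, a coarse geodesic from `x` to `y`, parametrized by the distance to `x`,
comes within distance about `(x.y)_q` of `q`. -/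
theorem exists_dist_le_gromovProduct_add {δ : ℝ}
    (hδ : ∀ p x y z : X, min (gromovProduct p x z) (gromovProduct p y z) - δ ≤ gromovProduct p x y)
    {x y : X} {ε : ℝ} (hε : 0 ≤ ε) {β : ℝ → X}
    (hβ : ∀ s ∈ Set.Icc 0 (dist x y), dist x (β s) = s ∧ dist (β s) y ≤ dist x y - s + ε) (q : X) :
    ∃ s ∈ Set.Icc 0 (dist x y), dist q (β s) ≤ gromovProduct q x y + ε + 2 * δ := by
  -- The parameter `(y.q)_x` is where the leg towards `q` branches off in the comparison tripod of
  -- `x`, `y`, `q`.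
  have hs : gromovProduct x y q ∈ Set.Icc 0 (dist x y) := by
    have h1 := dist_triangle y x q
    have h2 := dist_triangle x y q
    rw [dist_comm y x] at h1
    simp only [gromovProduct, Set.mem_Icc]
    constructor <;> linarith
  refine ⟨_, hs, ?_⟩
  obtain ⟨h1, h2⟩ := hβ _ hs
  generalize hz : β (gromovProduct x y q) = z at *
  -- As `(x.y)_z ≤ ε / 2`, one of `(x.q)_z`, `(y.q)_z` is small. Either case suffices: with `s =
  -- (y.q)_x`, both `d(x,q) - s` and `d(y,q) - (d(x,y) - s)` equal `(x.y)_q`.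
  have h3 := hδ z x y q
  simp only [gromovProduct, dist_comm z x, dist_comm q x, dist_comm q y, dist_comm q z] at *
  rcases min_cases ((dist x z + dist z q - dist x q) / 2)
    ((dist z y + dist z q - dist y q) / 2) with ⟨h, -⟩ | ⟨h, -⟩ <;> rw [h] at h3 <;> linarith

end GromovProduct

/-! ### Quasigeodesics from nearly shortest paths. -/

theorem dist_add_dist_add_dist_le_of_eVariationOn_le {X : Type*} [MetricSpace X] {x y : X}
    (γ : Path x y) {L : ℝ} (hL : 0 ≤ L)
    (hγ : eVariationOn (γ : unitInterval → X) Set.univ ≤ ENNReal.ofReal L)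
    {s t : unitInterval} (hst : s ≤ t) :
    dist x (γ s) + dist (γ s) (γ t) + dist (γ t) y ≤ L := by
  have h0 : (0 : unitInterval) ≤ s := unitInterval.nonneg'
  have h1 : t ≤ (1 : unitInterval) := unitInterval.le_one'
  have key : edist x (γ s) + edist (γ s) (γ t) + edist (γ t) y ≤ ENNReal.ofReal L := by
    refine le_trans ?_ ((eVariationOn.mono (γ : unitInterval → X)
      (Set.subset_univ (Set.univ ∩ Set.Icc 0 1))).trans hγ)
    rw [← eVariationOn.Icc_add_Icc (γ : unitInterval → X) (h0.trans hst) h1 (Set.mem_univ t),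
      ← eVariationOn.Icc_add_Icc (γ : unitInterval → X) h0 hst (Set.mem_univ s)]
    refine add_le_add (add_le_add ?_ ?_) ?_
    · simpa only [γ.source] using eVariationOn.edist_le (γ : unitInterval → X)
        (s := Set.univ ∩ Set.Icc 0 s) ⟨trivial, le_rfl, h0⟩ ⟨trivial, h0, le_rfl⟩
    · exact eVariationOn.edist_le _ ⟨trivial, le_rfl, hst⟩ ⟨trivial, hst, le_rfl⟩
    · simpa only [γ.target] using eVariationOn.edist_le (γ : unitInterval → X)
        (s := Set.univ ∩ Set.Icc t 1) ⟨trivial, le_rfl, h1⟩ ⟨trivial, h1, le_rfl⟩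
  rw [edist_dist, edist_dist, edist_dist, ← ENNReal.ofReal_add dist_nonneg dist_nonneg,
    ← ENNReal.ofReal_add (add_nonneg dist_nonneg dist_nonneg) dist_nonneg] at key
  exact (ENNReal.ofReal_le_ofReal_iff hL).1 key

/-- Points of a length space are joined by `(1, ε)`-quasigeodesics parametrized by the distance to
the initial point. -/
theorem IsLengthSpace.exists_quasigeodesic {X : Type*} [MetricSpace X] (hX : IsLengthSpace X)
    (x y : X) {ε : ℝ} (hε : 0 < ε) :
    ∃ α : ℝ → X, IsQuasigeodesicJoining 1 ε α 0 (dist x y) x y ∧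
      ∀ s ∈ Set.Icc 0 (dist x y), dist x (α s) = s ∧ dist (α s) y ≤ dist x y - s + ε := by
  obtain ⟨γ, hγ⟩ : ∃ γ : Path x y, eVariationOn (γ : unitInterval → X) Set.univ <
      ENNReal.ofReal (dist x y + ε) := by
    rw [← iInf_lt_iff, ← hX x y, edist_dist]
    exact (ENNReal.ofReal_lt_ofReal_iff (by positivity)).2 (by linarith)
  have hlen := fun s t : unitInterval => dist_add_dist_add_dist_le_of_eVariationOn_le γ
    (by positivity) hγ.le (s := s) (t := t)
  have hcont : Continuous fun t => dist x (γ t) := by fun_prop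
  -- the last time at which the path is at distance at most `s` from `x`
  have hlast : ∀ s : ℝ, ∃ t : unitInterval, 0 ≤ s → IsGreatest {t | dist x (γ t) ≤ s} t := by
    intro s
    by_cases hs : 0 ≤ s
    · obtain ⟨t, ht⟩ := (isClosed_le hcont continuous_const).isCompact.exists_isGreatest
        (s := {t | dist x (γ t) ≤ s}) ⟨0, by simpa using hs⟩
      exact ⟨t, fun _ => ht⟩
    · exact ⟨0, fun h => absurd h hs⟩
  choose τ hτ using hlast
  have hdist : ∀ s ∈ Set.Icc 0 (dist x y), dist x (γ (τ s)) = s := by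
    intro s hs
    refine le_antisymm (hτ s hs.1).1 ?_
    -- The value `s` is attained at or after `τ s`; maximality of `τ s` forces equality.
    obtain ⟨t, ht, hts⟩ := intermediate_value_Icc (unitInterval.le_one' (t := τ s))
      hcont.continuousOn (show s ∈ Set.Icc (dist x (γ (τ s))) (dist x (γ 1)) from
        ⟨(hτ s hs.1).1, by simpa using hs.2⟩)
    have h : t ≤ τ s := (hτ s hs.1).2 (show dist x (γ t) ≤ s from hts.le)
    rw [le_antisymm ht.1 h]
    exact hts.ge
  have hle : ∀ s ∈ Set.Icc 0 (dist x y), ∀ t ∈ Set.Icc 0 (dist x y), s ≤ t →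
      t - s ≤ dist (γ (τ s)) (γ (τ t)) ∧ dist (γ (τ s)) (γ (τ t)) ≤ t - s + ε := by
    intro s hs t ht hst
    -- Taking last times makes `τ` monotone, as the sublevel sets increase with the parameter.
    have h1 := hlen _ _ ((hτ t ht.1).2 (show dist x (γ (τ s)) ≤ t from (hdist s hs).le.trans hst))
    have h2 := dist_triangle x (γ (τ t)) y
    have h3 := dist_triangle x (γ (τ s)) (γ (τ t))
    rw [hdist s hs] at h1 h3
    rw [hdist t ht] at h2 h3
    constructor <;> linarith
  refine ⟨fun s => γ (τ s), ⟨dist_nonneg, ?_, ?_, ?_⟩, fun s hs => ⟨hdist s hs, ?_⟩⟩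
  · exact (dist_eq_zero.1 (hdist 0 ⟨le_rfl, dist_nonneg⟩)).symm
  · have : (1 : unitInterval) ≤ τ (dist x y) :=
      (hτ _ dist_nonneg).2 (show dist x (γ 1) ≤ dist x y by simp)
    simp only [le_antisymm unitInterval.le_one' this, γ.target]
  · intro s hs t ht
    rcases le_total s t with hst | hst
    · obtain ⟨h1, h2⟩ := hle s hs t ht hst
      rw [abs_sub_comm, abs_of_nonneg (sub_nonneg.2 hst)]
      constructor <;> linarith
    · obtain ⟨h1, h2⟩ := hle t ht s hs hst
      rw [abs_of_nonneg (sub_nonneg.2 hst), dist_comm (γ (τ s))]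
      constructor <;> linarith
  · have h := hlen (τ s) (τ s) le_rfl
    rw [hdist s hs, dist_self] at h
    linarith

/-! ### From Gromov products to the boundary map. -/

section Extension

variable {X Y : Type*} [MetricSpace X] [MetricSpace Y]

/-- Mitra's criterion in terms of Gromov products. -/
theorem tendsto_gromovProduct_comap_of_quasigeodesics [GromovHyperbolic X]
    (hX : IsLengthSpace X) (hY : IsLengthSpace Y) (f : Y → X) (p : Y)
    (M : ℝ → ℝ) (hM : Tendsto M atTop atTop)
    (hf : ∀ N : ℝ, 0 < N → ∀ (y₁ y₂ : Y) (α : ℝ → Y) (a b : ℝ) (β : ℝ → X) (c d : ℝ),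
      IsQuasigeodesicJoining 1 1 α a b y₁ y₂ →
      IsQuasigeodesicJoining 1 1 β c d (f y₁) (f y₂) →
      Disjoint (Metric.ball p N) (α '' Set.Icc a b) →
      Disjoint (Metric.ball (f p) (M N)) (β '' Set.Icc c d)) (q : X) :
    Tendsto (fun y : Y × Y => gromovProduct q (f y.1) (f y.2))
      (comap (fun y : Y × Y => gromovProduct p y.1 y.2) atTop) atTop := by
  obtain ⟨δ, -, hδ⟩ := GromovHyperbolic.exists_delta (X := X)
  refine tendsto_atTop.2 fun K => ?_
  -- The extra terms pay for moving the base point from `f p` to `q` and for the error `ε + 2 * δ`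
  -- with `ε = 1`.
  obtain ⟨N, hN, hMN⟩ := ((eventually_gt_atTop (0 : ℝ)).and
    (tendsto_atTop.1 hM (K + dist (f p) q + 1 + 2 * δ))).exists
  -- The error `1` of `α` costs only `1 / 2` in the product, so `N + 1` keeps `α` outside the ball.
  refine mem_of_superset (preimage_mem_comap (Ici_mem_atTop (N + 1))) fun y hy => ?_
  obtain ⟨α, hα, hα'⟩ := hY.exists_quasigeodesic y.1 y.2 one_pos
  obtain ⟨β, hβ, hβ'⟩ := hX.exists_quasigeodesic (f y.1) (f y.2) one_pos
  have hdisj : Disjoint (Metric.ball p N) (α '' Set.Icc 0 (dist y.1 y.2)) := by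
    refine Set.disjoint_left.2 ?_
    rintro _ hz ⟨s, hs, rfl⟩
    obtain ⟨h1, h2⟩ := hα' s hs
    have h3 := gromovProduct_le_dist_add (ε := 1) (show dist y.1 (α s) + dist (α s) y.2 ≤ _ by
      linarith) p
    have h4 : N + 1 ≤ gromovProduct p y.1 y.2 := hy
    rw [Metric.mem_ball, dist_comm] at hz
    linarith
  obtain ⟨s, hs, hsq⟩ := exists_dist_le_gromovProduct_add hδ zero_le_one hβ' (f p)
  have hfar := Set.disjoint_right.1 (hf N hN _ _ α _ _ β _ _ hα hβ hdisj)
    (Set.mem_image_of_mem β hs)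
  rw [Metric.mem_ball, not_lt, dist_comm] at hfar
  have := gromovProduct_sub_dist_le (f p) q (f y.1) (f y.2)
  rw [Set.mem_ofPred_eq]
  linarith

theorem GromovAsymptotic.map {f : Y → X} {p : Y}
    (hf : ∀ q : X, Tendsto (fun y : Y × Y => gromovProduct q (f y.1) (f y.2))
      (comap (fun y : Y × Y => gromovProduct p y.1 y.2) atTop) atTop)
    {x y : ℕ → Y} (h : GromovAsymptotic x y) : GromovAsymptotic (f ∘ x) (f ∘ y) := fun q =>
  (hf q).comp (g := fun y : Y × Y => gromovProduct q (f y.1) (f y.2))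
    (f := fun ij : ℕ × ℕ => (x ij.1, y ij.2)) (tendsto_comap_iff.2 (h p))

theorem ConvergesToBoundary.gromovAsymptotic [GromovHyperbolic X] {x y : ℕ → X}
    {ξ : GromovBoundary X} (hx : ConvergesToBoundary x ξ) (hy : ConvergesToBoundary y ξ) :
    GromovAsymptotic x y := by
  obtain ⟨h, rfl⟩ := hx
  obtain ⟨h', e⟩ := hy
  exact (Quotient.exact e.symm : _)

/-- Lower bounds on the Gromov products of two sequences pass to equivalent sequences. -/
theorem eventually_le_gromovProduct_of_asymptotic {δ : ℝ} (hδ₀ : 0 ≤ δ)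
    (hδ : ∀ p x y z : X, min (gromovProduct p x z) (gromovProduct p y z) - δ ≤ gromovProduct p x y)
    {x x' u u' : ℕ → X} (hx : GromovAsymptotic x x') (hu : GromovAsymptotic u u') {q : X} {K : ℝ}
    (h : ∀ᶠ ij : ℕ × ℕ in atTop, K + 2 * δ ≤ gromovProduct q (x' ij.1) (u' ij.2)) :
    ∀ᶠ ij : ℕ × ℕ in atTop, K ≤ gromovProduct q (x ij.1) (u ij.2) := by
  obtain ⟨⟨a, a'⟩, ha⟩ := eventually_atTop.1 (tendsto_atTop.1 (hx q) (K + 2 * δ))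
  obtain ⟨⟨b, b'⟩, hb⟩ := eventually_atTop.1 (tendsto_atTop.1 (hu q) (K + 2 * δ))
  obtain ⟨⟨c, c'⟩, hc⟩ := eventually_atTop.1 h
  refine eventually_atTop.2 ⟨(a, b), fun ij hij => ?_⟩
  have h1 := ha (ij.1, max a' c) ⟨hij.1, le_max_left _ _⟩
  have h2 := hb (ij.2, max b' c') ⟨hij.2, le_max_left _ _⟩
  have h3 := hc (max a' c, max b' c') ⟨le_max_right _ _, le_max_right _ _⟩
  simp only at h1 h2 h3
  -- The chain `u`, `u'`, `x'`, `x` uses hyperbolicity twice, hence `2 * δ`.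
  have h4 := hδ q (x' (max a' c)) (u ij.2) (u' (max b' c'))
  have h5 := hδ q (x ij.1) (u ij.2) (x' (max a' c))
  rw [gromovProduct_comm q (u ij.2) (x' _)] at h5
  have h6 := le_min h3 h2
  have h7 : K + δ ≤ min (gromovProduct q (x ij.1) (x' (max a' c)))
      (gromovProduct q (x' (max a' c)) (u ij.2)) := le_min (by linarith) (by linarith)
  linarith

theorem isClosed_gromovBoundary_iff [GromovHyperbolic X] {A : Set (GromovBoundary X)} :
    IsClosed A ↔ ∀ (ξs : ℕ → GromovBoundary X) (ξ : GromovBoundary X),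
      (∀ n, ξs n ∈ A) → BoundaryTendsto ξs ξ → ξ ∈ A := by
  rw [← isOpen_compl_iff]
  change Aᶜᶜ ∈ {A : Set (GromovBoundary X) | _} ↔ _
  rw [compl_compl]
  rfl

/-- Closed sets are defined by sequential limits, so sequential continuity suffices. -/
theorem continuous_of_boundaryTendsto [GromovHyperbolic X] [GromovHyperbolic Y]
    {F : GromovBoundary Y → GromovBoundary X}
    (hF : ∀ ξs ξ, BoundaryTendsto ξs ξ → BoundaryTendsto (F ∘ ξs) (F ξ)) : Continuous F :=
  continuous_iff_isClosed.2 fun _ hA => isClosed_gromovBoundary_iff.2 fun ξs ξ h hξ =>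
    isClosed_gromovBoundary_iff.1 hA (F ∘ ξs) (F ξ) h (hF _ _ hξ)

theorem cannonThurstonMapExists_of_tendsto_gromovProduct [GromovHyperbolic X] [GromovHyperbolic Y]
    {f : Y → X} {p : Y}
    (hf : ∀ q : X, Tendsto (fun y : Y × Y => gromovProduct q (f y.1) (f y.2))
      (comap (fun y : Y × Y => gromovProduct p y.1 y.2) atTop) atTop) :
    CannonThurstonMapExists f := by
  let F : GromovBoundary Y → GromovBoundary X :=
    Quotient.map' (fun x => ⟨f ∘ x.1, GromovAsymptotic.map hf x.2⟩)
      (fun _ _ h => GromovAsymptotic.map hf h)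
  have hF : ∀ (ξ : GromovBoundary Y) (y : ℕ → Y),
      ConvergesToBoundary y ξ → ConvergesToBoundary (f ∘ y) (F ξ) := by
    rintro _ y ⟨h, rfl⟩
    exact ⟨GromovAsymptotic.map hf h, rfl⟩
  refine ⟨F, continuous_of_boundaryTendsto fun ξs ξ hξ q u x hu hx => ?_, hF⟩
  obtain ⟨δ, hδ₀, hδ⟩ := GromovHyperbolic.exists_delta (X := X)
  -- The representatives `x` and `u n` in `X` need not be images under `f`; they are compared with
  -- `f ∘ w` and `f ∘ v n`.
  choose v hv using fun n => exists_convergesToBoundary (ξs n)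
  obtain ⟨w, hw⟩ := exists_convergesToBoundary ξ
  refine EReal.tendsto_nhds_top_iff_real.2 fun K => ?_
  obtain ⟨N, hN⟩ : ∃ N : ℝ, ∀ y : Y × Y, N ≤ gromovProduct p y.1 y.2 →
      K + 1 + 2 * δ ≤ gromovProduct q (f y.1) (f y.2) := by
    obtain ⟨s, hs, hsub⟩ := tendsto_atTop.1 (hf q) (K + 1 + 2 * δ)
    obtain ⟨N, hN⟩ := mem_atTop_sets.1 hs
    exact ⟨N, fun y hy => hsub (hN _ hy)⟩
  filter_upwards [EReal.tendsto_nhds_top_iff_real.1 (hξ p v w hv hw) N] with n hn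
  have h1 := eventually_le_gromovProduct_of_asymptotic hδ₀ hδ (q := q) (K := K + 1)
    (hx.gromovAsymptotic (hF ξ w hw)) ((hu n).gromovAsymptotic (hF _ _ (hv n)))
    ((eventually_lt_of_lt_liminf hn).mono fun ij hij =>
      hN (w ij.1, v n ij.2) (EReal.coe_lt_coe_iff.1 hij).le)
  -- A lower bound passes to the liminf only as `≤`; the spare `1` gives the strict inequality.
  refine lt_of_lt_of_le (EReal.coe_lt_coe_iff.2 (lt_add_one K)) (le_liminf_of_le ?_ ?_)
  · isBoundedDefault
  · exact h1.mono fun ij hij => EReal.coe_le_coe_iff.2 hij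

end Extension

theorem mainTheorem2 {X Y : Type*} [MetricSpace X] [MetricSpace Y]
    [GromovHyperbolic X] [GromovHyperbolic Y]
    (hX : IsLengthSpace X) (hY : IsLengthSpace Y) (f : Y → X) (p : Y)
    (M : ℝ → ℝ) (hM : Tendsto M atTop atTop)
    (hf : ∀ N : ℝ, 0 < N → ∀ (y₁ y₂ : Y) (α : ℝ → Y) (a b : ℝ) (β : ℝ → X) (c d : ℝ),
      IsQuasigeodesicJoining 1 1 α a b y₁ y₂ →
      IsQuasigeodesicJoining 1 1 β c d (f y₁) (f y₂) →
      Disjoint (Metric.ball p N) (α '' Set.Icc a b) →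
      Disjoint (Metric.ball (f p) (M N)) (β '' Set.Icc c d)) :
    CannonThurstonMapExists f := by
  exact cannonThurstonMapExists_of_tendsto_gromovProduct
    (tendsto_gromovProduct_comap_of_quasigeodesics hX hY f p M hM hf)
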